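/- Let $\alpha\in(0,2)$, let $E\in\mathbb R^{d\times d}$ and $D\in\mathbb R^{m\times m}$, and write $c^A=\exp(A\log c)$ for $c>0$ and a square matrix $A$. Let $\lambda_1\le\dots\le\lambda_m$ be the real parts of the (complex) eigenvalues of $D$, counted with multiplicity, and assume that $0<\lambda_1$, that $\lambda_m<1$, and that every eigenvalue of $E$ has real part greater than $1$. Put $q=\operatorname{trace}(E)$. Let $\psi:\mathbb R^d\to[0,\infty)$ be continuous with $\psi(x)\ne0$ for $x\neq0$ and $\psi(c^{E^{T}}x)=c\,\psi(x)$ for all $c>0$, $x\in\mathbb R^d$. Let $W$ be a $\mathbb C^m$-valued isotropic $\alpha$-stable random measure on $\mathbb R^d$ with Lebesgue control measure, i.e. an independently scattered, almost surely $\sigma$-additive random set function on the Borel sets of finite Lebesgue measure with $\mathbb E\big[\exp(i\operatorname{Re}\langle \zeta,W(A)\rangle)\big]=\exp(-|A|\,\|\zeta\|^\alpha)$ for $\zeta\in\mathbb C^m$. Let $X=\{X(t):t\in\mathbb R^d\}$ be the harmonizable $(E,D)$-operator-self-similar random field $$X(t)=\operatorname{Re}\int_{\mathbb R^d}\big(e^{i\langle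 t,y\rangle}-1\big)\,\psi(y)^{-D-\frac q\alpha I_m}\,W(dy),\qquad t\in\mathbb R^d,$$ where the stochastic integral of a matrix-valued kernel is the limit in probability of the integrals of simple functions converging to the kernel in $L^\alpha$. Let $\|\cdot\|_0$ be a norm on $\mathbb R^d$ such that $r\mapsto\|r^Ex\|_0$ is strictly increasing on $(0,\infty)$ for every $x\neq0$, and let $\tau_E$ be the radial part of the corresponding polar coordinates: $\tau_E(0)=0$, and for $x\ne0$, $\tau_E(x)$ is the unique $r>0$ such that $x=r^El$ for some $l$ with $\|l\|_0=1$. Assume that $D$ is in real canonical form, i.e. block diagonal with blocks that are Jordan cells $$\begin{pmatrix}\lambda&1&&\\&\lambda&\ddots&\\&&\ddots&1\\&&&\lambda\end{pmatrix}\quad\text{or}\quad\begin{pmatrix}\Lambda&I_2&&\\&\Lambda&\ddots&\\&&\ddots&I_2\\&&&\Lambda\end{pmatrix},\quad \Lambda=\begin{pmatrix}a&-b\\b&a\end{pmatrix},\ b\neq0,$$ with the blocks arranged so that the $j$-th diagonal entry of $D$ is $\lambda_j$, $1\le j\le m$. Then for every $\varepsilon>0$ and every $T>0$ there is a constant $C>0$,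 depending only on $\varepsilon$, $T$ and the data $d,m,\alpha,E,D,\psi,\|\cdot\|_0$ (and not on $t$, $\theta$), such that for all $t\in\mathbb R^d$ with $\tau_E(t)\le T$ and all $\theta\in\mathbb R^m$ the characteristic function $\mathbb E[\exp(i\langle X(t),\theta\rangle)]$ is real and $$\mathbb E\big[\exp\big(i\langle X(t),\theta\rangle\big)\big]\le\exp\Big(-C\sum_{j=1}^m\big|\tau_E(t)^{\lambda_j+\varepsilon}|\theta_j|\big|^\alpha\Big).$$ -/

import Mathlib

open MeasureTheory ProbabilityTheory Filter Topology
open scoped ComplexOrder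

noncomputable section

/-- The matrix power `c ^ A = exp (A log c)`, for `c > 0`. -/
def matPow {n : ℕ} (c : ℝ) (A : Matrix (Fin n) (Fin n) ℝ) : Matrix (Fin n) (Fin n) ℝ :=
  NormedSpace.exp (Real.log c • A)

/-- A square matrix acting on column vectors of the Euclidean space. -/
def matAct {𝕜 : Type*} [RCLike 𝕜] {n : ℕ} (A : Matrix (Fin n) (Fin n) 𝕜)
    (x : EuclideanSpace 𝕜 (Fin n)) : EuclideanSpace 𝕜 (Fin n) :=
  Matrix.toEuclideanCLM (n := Fin n) (𝕜 := 𝕜) A x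

/-- The operator norm of a complex matrix for the Euclidean norm, as an extended real. -/
def opENorm {n : ℕ} (A : Matrix (Fin n) (Fin n) ℂ) : ENNReal :=
  ‖Matrix.toEuclideanCLM (n := Fin n) (𝕜 := ℂ) A‖ₑ

/-- The real parts of the complex eigenvalues of a real matrix, with algebraic multiplicity. -/
def eigenvalueRealParts {n : ℕ} (A : Matrix (Fin n) (Fin n) ℝ) : Multiset ℝ :=
  (A.map (algebraMap ℝ ℂ)).charpoly.roots.map Complex.re

/-! ### The real canonical form -/

/-- The `n × n` Jordan cell with real eigenvalue `l`. -/
def jordanCell (n : ℕ) (l : ℝ) : Matrix (Fin n) (Fin n) ℝ :=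
  Matrix.of fun i j =>
    if i = j then l else if (i : ℕ) + 1 = (j : ℕ) then 1 else 0

/-- The `2k × 2k` cell with the `2 × 2` blocks `Λ = (a, -b; b, a)` on the block diagonal and
the identity `I₂` on the block superdiagonal. -/
def complexJordanCell (k : ℕ) (a b : ℝ) : Matrix (Fin (2 * k)) (Fin (2 * k)) ℝ :=
  Matrix.of fun i j =>
    if (i : ℕ) / 2 = (j : ℕ) / 2 then
      if (i : ℕ) % 2 = (j : ℕ) % 2 then a else if (i : ℕ) % 2 = 0 then -b else b
    else if (i : ℕ) / 2 + 1 = (j : ℕ) / 2 ∧ (i : ℕ) % 2 = (j : ℕ) % 2 then 1 else 0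

inductive IsRealJordanCell : (n : ℕ) → Matrix (Fin n) (Fin n) ℝ → Prop
  | real (n : ℕ) (l : ℝ) : IsRealJordanCell n (jordanCell n l)
  | complex (k : ℕ) (a b : ℝ) (hb : b ≠ 0) :
      IsRealJordanCell (2 * k) (complexJordanCell k a b)

/-- `D` is block diagonal, and its consecutive diagonal blocks are cells of the two kinds above. -/
def IsRealCanonicalForm {m : ℕ} (D : Matrix (Fin m) (Fin m) ℝ) : Prop :=
  ∃ (k : ℕ) (n : Fin k → ℕ) (B : ∀ i, Matrix (Fin (n i)) (Fin (n i)) ℝ) (h : ∑ i, n i = m),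
    (∀ i, IsRealJordanCell (n i) (B i)) ∧
    D = (Matrix.blockDiagonal' B).reindex
      (finSigmaFinEquiv.trans (finCongr h)) (finSigmaFinEquiv.trans (finCongr h))

/-! ### Polar coordinates -/

/-- `N` is a norm for which `r ↦ N (r ^ E x)` is strictly increasing on `(0, ∞)` for each `x ≠ 0`.
When the eigenvalues of `E` have positive real parts, this is what makes `(r, l) ↦ r ^ E l`
a bijection (and a homeomorphism) from `(0, ∞) × {N = 1}` onto `ℝ^d \ {0}`. -/
structure IsPolarNorm {d : ℕ} (E : Matrix (Fin d) (Fin d) ℝ)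
    (N : Seminorm ℝ (EuclideanSpace ℝ (Fin d))) : Prop where
  eq_zero : ∀ x, N x = 0 → x = 0
  strictMono : ∀ x, x ≠ 0 → StrictMonoOn (fun r : ℝ => N (matAct (matPow r E) x)) (Set.Ioi 0)

open Classical in
/-- The radial part `τ_E (x)` : the `r > 0` with `x = r ^ E l` for some `l` with `N l = 1`;
there is none for `x = 0`, and `τ_E (0) = 0`. -/
def radialPart {d : ℕ} (E : Matrix (Fin d) (Fin d) ℝ)
    (N : Seminorm ℝ (EuclideanSpace ℝ (Fin d))) (x : EuclideanSpace ℝ (Fin d)) : ℝ :=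
  if h : ∃ r : ℝ, 0 < r ∧ ∃ l, N l = 1 ∧ x = matAct (matPow r E) l then h.choose else 0

/-! ### Isotropic stable random measures and stochastic integrals -/

/-- `W` is a `ℂ^m`-valued isotropic `α`-stable random measure on `ℝ^d` with Lebesgue control
measure: an independently scattered, almost surely `σ`-additive set function on the Borel sets of
finite Lebesgue measure, such that `W A`, as a vector of `ℂ^m = ℝ^(2m)`, is isotropic `α`-stable
with characteristic function `ζ ↦ exp (-|A| ‖ζ‖ ^ α)`. -/
structure IsIsotropicStableMeasure {Ω : Type*} [MeasurableSpace Ω] {d m : ℕ} (P : Measure Ω)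
    (α : ℝ) (W : Set (EuclideanSpace ℝ (Fin d)) → Ω → EuclideanSpace ℂ (Fin m)) : Prop where
  measurable : ∀ A, MeasurableSet A → volume A < ⊤ → Measurable (W A)
  charFun : ∀ A, MeasurableSet A → volume A < ⊤ → ∀ ζ : EuclideanSpace ℂ (Fin m),
    ∫ ω, Complex.exp (Complex.I * ((inner ℂ ζ (W A ω)).re : ℂ)) ∂P
      = (Real.exp (-((volume A).toReal * ‖ζ‖ ^ α)) : ℂ)
  indep : ∀ (n : ℕ) (A : Fin n → Set (EuclideanSpace ℝ (Fin d))),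
    (∀ i, MeasurableSet (A i)) → (∀ i, volume (A i) < ⊤) → Pairwise (Function.onFun Disjoint A) →
    iIndepFun (fun i => W (A i)) P
  additive : ∀ A : ℕ → Set (EuclideanSpace ℝ (Fin d)),
    (∀ i, MeasurableSet (A i)) → Pairwise (Function.onFun Disjoint A) → volume (⋃ i, A i) < ⊤ →
    ∀ᵐ ω ∂P, Tendsto (fun n => ∑ i ∈ Finset.range n, W (A i) ω) atTop (𝓝 (W (⋃ i, A i) ω))

/-- The integral `∑ R, R W({S = R})` of a matrix-valued simple function
(the value `R = 0` contributes `0`). -/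
def simpleIntegral {Ω : Type*} {d m : ℕ}
    (W : Set (EuclideanSpace ℝ (Fin d)) → Ω → EuclideanSpace ℂ (Fin m))
    (S : SimpleFunc (EuclideanSpace ℝ (Fin d)) (Matrix (Fin m) (Fin m) ℂ)) (ω : Ω) :
    EuclideanSpace ℂ (Fin m) :=
  ∑ R ∈ S.range, matAct R (W (S ⁻¹' {R}) ω)

/-- `Y = ∫ Q(u) W(du)` : `Y` is the limit in probability of the integrals of simple functions
that vanish outside sets of finite measure and converge to `Q` in `L^α`. -/
def IsStochasticIntegral {Ω : Type*} [MeasurableSpace Ω] {d m : ℕ} (P : Measure Ω) (α : ℝ)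
    (W : Set (EuclideanSpace ℝ (Fin d)) → Ω → EuclideanSpace ℂ (Fin m))
    (Q : EuclideanSpace ℝ (Fin d) → Matrix (Fin m) (Fin m) ℂ)
    (Y : Ω → EuclideanSpace ℂ (Fin m)) : Prop :=
  ∃ S : ℕ → SimpleFunc (EuclideanSpace ℝ (Fin d)) (Matrix (Fin m) (Fin m) ℂ),
    (∀ n, (S n).FinMeasSupp volume) ∧
    Tendsto (fun n => ∫⁻ u, opENorm (S n u - Q u) ^ α) atTop (𝓝 0) ∧
    TendstoInMeasure P (fun n => simpleIntegral W (S n)) atTop Y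

/-! ### The harmonizable field -/

/-- `ψ : ℝ^d → [0, ∞)` is continuous, `E^T`-homogeneous and does not vanish outside the origin. -/
structure IsHomogeneousWeight {d : ℕ} (E : Matrix (Fin d) (Fin d) ℝ)
    (ψ : EuclideanSpace ℝ (Fin d) → ℝ) : Prop where
  continuous : Continuous ψ
  nonneg : ∀ x, 0 ≤ ψ x
  homogeneous : ∀ c : ℝ, 0 < c → ∀ x, ψ (matAct (matPow c E.transpose) x) = c * ψ x
  ne_zero : ∀ x, x ≠ 0 → ψ x ≠ 0

/-- The kernel `y ↦ (e^{i⟨x, y⟩} - 1) ψ(y) ^ (-D - (q/α) I)` with `q = trace E`. -/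
def harmonizableKernel {d m : ℕ} (α : ℝ) (E : Matrix (Fin d) (Fin d) ℝ)
    (D : Matrix (Fin m) (Fin m) ℝ) (ψ : EuclideanSpace ℝ (Fin d) → ℝ)
    (x y : EuclideanSpace ℝ (Fin d)) : Matrix (Fin m) (Fin m) ℂ :=
  (Complex.exp (Complex.I * (inner ℝ x y : ℝ)) - 1) •
    (matPow (ψ y) (-D - (E.trace / α) • (1 : Matrix (Fin m) (Fin m) ℝ))).map (algebraMap ℝ ℂ)

/-- `X(x) = Re ∫ (e^{i⟨x, y⟩} - 1) ψ(y) ^ (-D - (q/α) I) W(dy)` almost surely, for each `x`. -/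
def IsHarmonizableField {Ω : Type*} [MeasurableSpace Ω] {d m : ℕ} (P : Measure Ω) (α : ℝ)
    (W : Set (EuclideanSpace ℝ (Fin d)) → Ω → EuclideanSpace ℂ (Fin m))
    (E : Matrix (Fin d) (Fin d) ℝ) (D : Matrix (Fin m) (Fin m) ℝ)
    (ψ : EuclideanSpace ℝ (Fin d) → ℝ)
    (X : EuclideanSpace ℝ (Fin d) → Ω → EuclideanSpace ℝ (Fin m)) : Prop :=
  ∀ x, ∃ Y : Ω → EuclideanSpace ℂ (Fin m),
    IsStochasticIntegral P α W (harmonizableKernel α E D ψ x) Y ∧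
    ∀ᵐ ω ∂P, ∀ j, X x ω j = (Y ω j).re

end

/-!
Write `q = trace E` and `κ = q / α`. The characteristic function of `X(t)` at `θ` is
`exp (-∫ ‖Q_t(y)ᴴ θ‖ ^ α dy)`, where `Q_t` is the harmonizable kernel and

  `‖Q_t(y)ᴴ θ‖ = |e ^ (i⟨t, y⟩) - 1| ‖ψ(y) ^ (-Dᵀ - κ) θ‖`,

so an upper bound for it is a lower bound for the integral.

For simple kernels the formula is the independence of `W` on disjoint sets. In the limit only an
inequality is kept (`IsStochasticIntegral.exists_integral_exp_eq`): the integrals of the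
approximating simple functions converge almost surely along a subsequence, and `∫ ‖Q_tᴴ θ‖ ^ α` is
at most `2 ^ α` times the limit of the exponents. The limit of positive numbers is real, which also
gives realness.

For the lower bound write `t = r ^ E l` with `r = τ_E(t)` and `‖l‖₀ = 1`. On the set of those `y`
for which `z = r ^ Eᵀ y` lies in a small ball around `l / ‖l‖²`, one has `⟨t, y⟩ = ⟨l, z⟩` near `1`,
and `ψ(y) = ψ(z) / r` with `ψ(z)` bounded away from `0` and `∞`. This set has measure `r ^ (-q)`
times that of the ball, because `det (r ^ E) = r ^ q` (`det_exp_smul`). The factor `r ^ (-q)`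
cancels the `r ^ q` produced by `ψ(y) ^ (-κ)`, and `‖r ^ Dᵀ θ‖ ^ α` remains to be bounded below by
a multiple of `∑ⱼ (r ^ (λⱼ + ε) |θⱼ|) ^ α` (`exists_le_lintegral_harmonizableKernel`).

That is a bound for the rows of `e ^ (s Dᵀ)` by `e ^ (s λⱼ + ε |s|)`
(`IsNearlyNormal.exists_abs_exp_mulVec_le`). A diagonal change of basis makes the superdiagonal part
of a real canonical form arbitrarily small; the rotation blocks are skew-symmetric and do not affect
the Euclidean norm, so Gronwall's inequality for the weighted norm of `e ^ (s (D - diag λ)ᵀ) x`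
gives the growth rate `ε`.
-/

open MeasureTheory ProbabilityTheory Filter Topology
open scoped ComplexOrder

/-! ### Matrix exponentials -/

section Exponential

open scoped Matrix.Norms.Operator

theorem hasDerivAt_exp_smul_apply {n : ℕ} (A : Matrix (Fin n) (Fin n) ℝ) (s : ℝ) (i j : Fin n) :
    HasDerivAt (fun s : ℝ => NormedSpace.exp (s • A) i j)
      ((A * NormedSpace.exp (s • A)) i j) s := by
  have h := hasDerivAt_exp_smul_const' (𝕂 := ℝ) A s
  have h2 := hasDerivAt_pi.1 (hasDerivAt_pi.1 h i) j
  exact h2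

theorem exp_add_smul {n : ℕ} (A : Matrix (Fin n) (Fin n) ℝ) (s t : ℝ) :
    NormedSpace.exp ((s + t) • A) = NormedSpace.exp (s • A) * NormedSpace.exp (t • A) := by
  rw [add_smul]
  exact Matrix.exp_add_of_commute _ _ (((Commute.refl A).smul_left s).smul_right t)

end Exponential

theorem exp_neg_smul_mul {n : ℕ} (A : Matrix (Fin n) (Fin n) ℝ) (s : ℝ) :
    NormedSpace.exp ((-s) • A) * NormedSpace.exp (s • A) = 1 := by
  rw [← exp_add_smul]
  simp

theorem hasDerivAt_exp_smul_mulVec {n : ℕ} (A : Matrix (Fin n) (Fin n) ℝ) (x : Fin n → ℝ) (s : ℝ)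
    (i : Fin n) :
    HasDerivAt (fun s : ℝ => (NormedSpace.exp (s • A)).mulVec x i)
      (A.mulVec ((NormedSpace.exp (s • A)).mulVec x) i) s := by
  rw [Matrix.mulVec_mulVec]
  have h : HasDerivAt (fun s : ℝ => ∑ j, NormedSpace.exp (s • A) i j * x j)
      (∑ j, (A * NormedSpace.exp (s • A)) i j * x j) s :=
    HasDerivAt.fun_sum fun j _ => (hasDerivAt_exp_smul_apply A s i j).mul_const (x j)
  exact h

/-- A permutation other than the identity moves a point different from any prescribed one, so
it contributes nothing to the first-order expansion of the determinant at the identity. -/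
theorem exists_ne_and_apply_ne {ι : Type*} {σ : Equiv.Perm ι} (hσ : σ ≠ 1) (i : ι) :
    ∃ k, k ≠ i ∧ σ k ≠ k := by
  obtain ⟨a, ha⟩ := not_forall.1 fun h => hσ (Equiv.ext h)
  by_cases hai : a = i
  · subst hai
    exact ⟨σ a, ha, fun h => ha (σ.injective h)⟩
  · exact ⟨a, hai, ha⟩

/-- Jacobi's formula at the identity. -/
theorem hasDerivAt_det_of_eq_one {n : ℕ} {G : ℝ → Matrix (Fin n) (Fin n) ℝ}
    {A : Matrix (Fin n) (Fin n) ℝ} {s : ℝ} (hG : ∀ i j, HasDerivAt (fun s => G s i j) (A i j) s)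
    (h1 : G s = 1) : HasDerivAt (fun s => (G s).det) A.trace s := by
  simp only [Matrix.det_apply']
  have h : HasDerivAt (fun s => ∑ σ : Equiv.Perm (Fin n), ((Equiv.Perm.sign σ : ℤ) : ℝ) *
      ∏ i, G s (σ i) i)
      (∑ σ : Equiv.Perm (Fin n), ((Equiv.Perm.sign σ : ℤ) : ℝ) *
        ∑ i, (∏ j ∈ Finset.univ.erase i, G s (σ j) j) • A (σ i) i) s :=
    HasDerivAt.fun_sum fun σ _ =>
      (HasDerivAt.fun_finsetProd fun i _ => hG (σ i) i).const_mul _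
  convert h using 1
  rw [Finset.sum_eq_single 1]
  · simp [h1, Matrix.trace]
  · intro σ _ hσ
    rw [Finset.sum_eq_zero, mul_zero]
    intro i _
    obtain ⟨k, hki, hk⟩ := exists_ne_and_apply_ne hσ i
    rw [Finset.prod_eq_zero (Finset.mem_erase.2 ⟨hki, Finset.mem_univ k⟩), zero_smul]
    rw [h1, Matrix.one_apply_ne hk]
  · simp

theorem det_exp_smul {n : ℕ} (A : Matrix (Fin n) (Fin n) ℝ) (s : ℝ) :
    (NormedSpace.exp (s • A)).det = Real.exp (s * A.trace) := by
  have h0 : HasDerivAt (fun s : ℝ => (NormedSpace.exp (s • A)).det) A.trace 0 := by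
    refine hasDerivAt_det_of_eq_one (fun i j => ?_) (by simp)
    simpa using hasDerivAt_exp_smul_apply A 0 i j
  have hd : ∀ s, HasDerivAt (fun s : ℝ => (NormedSpace.exp (s • A)).det)
      ((NormedSpace.exp (s • A)).det * A.trace) s := by
    intro s
    have h1 : HasDerivAt (fun u : ℝ => (NormedSpace.exp (s • A)).det *
        (NormedSpace.exp ((u - s) • A)).det) ((NormedSpace.exp (s • A)).det * A.trace) s := by
      refine HasDerivAt.const_mul _ ?_
      rw [← sub_self s] at h0
      exact HasDerivAt.comp_sub_const s s h0
    refine h1.congr_of_eventuallyEq (Eventually.of_forall fun u => ?_)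
    simp only
    rw [← Matrix.det_mul, ← exp_add_smul]
    simp
  have hc : ∀ s, HasDerivAt (fun s : ℝ => (NormedSpace.exp (s • A)).det *
      Real.exp (-(s * A.trace))) 0 s := by
    intro s
    have h2 : HasDerivAt (fun s : ℝ => Real.exp (-(s * A.trace)))
        (Real.exp (-(s * A.trace)) * -(1 * A.trace)) s :=
      (((hasDerivAt_id s).mul_const A.trace).neg).exp
    exact ((hd s).mul h2).congr_deriv (by ring)
  have hconst := is_const_of_deriv_eq_zero (fun s => (hc s).differentiableAt)
    (fun s => (hc s).deriv) s 0
  simp only [zero_smul, NormedSpace.exp_zero, Matrix.det_one, zero_mul, neg_zero, Real.exp_zero,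
    mul_one] at hconst
  rw [Real.exp_neg] at hconst
  field_simp at hconst
  exact hconst

/-! ### Growth of the exponential of a matrix in real canonical form -/

/-- `M` is skew-symmetric up to a diagonal change of basis and an arbitrarily small error: for every
`δ > 0` there are a positive diagonal matrix `P = diag p` and a skew-symmetric matrix `R` such that
the entries of `P⁻¹ M P - R` are at most `δ` in absolute value. -/
def IsNearlySkew {ι : Type*} (M : Matrix ι ι ℝ) : Prop :=
  ∀ δ : ℝ, 0 < δ → ∃ p : ι → ℝ, (∀ i, 0 < p i) ∧ ∃ R : Matrix ι ι ℝ, (∀ i j, R j i = -R i j) ∧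
    ∀ i j, |M i j * p j - p i * R i j| ≤ δ * p i

/-- `D` commutes with `diag lam` (it has no entries between different values of `lam`), and
`D - diag lam` is nearly skew-symmetric. This is all that is used of a real canonical form. -/
structure IsNearlyNormal {ι : Type*} [DecidableEq ι] (D : Matrix ι ι ℝ) (lam : ι → ℝ) :
    Prop where
  eq_of_ne_zero : ∀ i j, D i j ≠ 0 → lam i = lam j
  nearlySkew : IsNearlySkew (D - Matrix.diagonal lam)

theorem isNearlyNormal_jordanCell (n : ℕ) (l : ℝ) :
    IsNearlyNormal (jordanCell n l) fun _ => l := by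
  refine ⟨fun _ _ _ => rfl, fun δ hδ => ⟨fun i => δ ^ (i : ℕ), fun i => by positivity, 0,
    fun _ _ => by simp, fun i j => ?_⟩⟩
  have h : (jordanCell n l - Matrix.diagonal (fun _ : Fin n => l)) i j =
      if (i : ℕ) + 1 = j then 1 else 0 := by
    by_cases hij : i = j
    · subst hij; simp [jordanCell]
    · simp [jordanCell, hij]
  rw [h]
  split_ifs with hs
  · change |1 * δ ^ (j : ℕ) - δ ^ (i : ℕ) * 0| ≤ δ * δ ^ (i : ℕ)
    rw [← hs, one_mul, mul_zero, sub_zero, abs_of_pos (by positivity), pow_succ, mul_comm]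
  · simp only [zero_mul, Matrix.zero_apply, mul_zero, sub_zero, abs_zero]
    positivity

theorem isNearlyNormal_complexJordanCell (k : ℕ) (a b : ℝ) :
    IsNearlyNormal (complexJordanCell k a b) fun _ => a := by
  refine ⟨fun _ _ _ => rfl, fun δ hδ => ⟨fun i => δ ^ ((i : ℕ) / 2), fun i => by positivity,
    Matrix.of fun i j => if (i : ℕ) / 2 = (j : ℕ) / 2 ∧ (i : ℕ) % 2 ≠ (j : ℕ) % 2 then
      (if (i : ℕ) % 2 = 0 then -b else b) else 0,
    fun i j => ?_, fun i j => ?_⟩⟩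
  · simp only [Matrix.of_apply]
    have hi := Nat.mod_two_eq_zero_or_one i
    have hj := Nat.mod_two_eq_zero_or_one j
    by_cases h : (i : ℕ) / 2 = (j : ℕ) / 2
    · rcases hi with hi | hi <;> rcases hj with hj | hj <;> simp [h, hi, hj]
    · simp [h, Ne.symm h]
  · simp only [Matrix.of_apply, Matrix.sub_apply, complexJordanCell]
    have hpos : 0 ≤ δ * δ ^ ((i : ℕ) / 2) := by positivity
    by_cases h : (i : ℕ) / 2 = (j : ℕ) / 2
    · by_cases h2 : (i : ℕ) % 2 = (j : ℕ) % 2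
      · have hij : i = j := Fin.ext (by omega)
        subst hij
        simpa using hpos
      · have hij : i ≠ j := fun h => h2 (by rw [h])
        have h3 : (i : ℕ) / 2 = (j : ℕ) / 2 ∧ (i : ℕ) % 2 ≠ (j : ℕ) % 2 := ⟨h, h2⟩
        rw [if_pos h, if_neg h2, if_pos h3, Matrix.diagonal_apply_ne _ hij, ← h, sub_zero,
          mul_comm, sub_self, abs_zero]
        exact hpos
    · have hij : i ≠ j := fun h' => h (by rw [h'])
      have h3 : ¬((i : ℕ) / 2 = (j : ℕ) / 2 ∧ (i : ℕ) % 2 ≠ (j : ℕ) % 2) := fun h' => h h'.1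
      rw [if_neg h, if_neg h3, Matrix.diagonal_apply_ne _ hij, sub_zero, mul_zero, sub_zero]
      split_ifs with h2
      · rw [← h2.1, one_mul, abs_of_pos (by positivity), pow_succ, mul_comm]
      · simpa using hpos

theorem IsRealJordanCell.isNearlyNormal {n : ℕ} {B : Matrix (Fin n) (Fin n) ℝ}
    (h : IsRealJordanCell n B) : IsNearlyNormal B fun i => B i i := by
  cases h with
  | real n l => simpa [jordanCell] using isNearlyNormal_jordanCell n l
  | complex k a b hb => simpa [complexJordanCell] using isNearlyNormal_complexJordanCell k a b

theorem IsNearlyNormal.blockDiagonal' {k : ℕ} {n : Fin k → ℕ}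
    {B : ∀ i, Matrix (Fin (n i)) (Fin (n i)) ℝ} {lam : ∀ i, Fin (n i) → ℝ}
    (h : ∀ i, IsNearlyNormal (B i) (lam i)) :
    IsNearlyNormal (Matrix.blockDiagonal' B) fun x => lam x.1 x.2 := by
  constructor
  · rintro ⟨i, a⟩ ⟨j, b⟩ hne
    by_cases hij : i = j
    · subst hij
      rw [Matrix.blockDiagonal'_apply_eq] at hne
      exact (h i).eq_of_ne_zero a b hne
    · exact absurd (Matrix.blockDiagonal'_apply_ne _ _ _ hij) hne
  · intro δ hδ
    choose p hp R hR hM using fun i => (h i).nearlySkew δ hδ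
    refine ⟨fun x => p x.1 x.2, fun x => hp _ _, Matrix.blockDiagonal' R, ?_, ?_⟩
    · rintro ⟨i, a⟩ ⟨j, b⟩
      by_cases hij : i = j
      · subst hij
        simp only [Matrix.blockDiagonal'_apply_eq]
        exact hR i a b
      · rw [Matrix.blockDiagonal'_apply_ne _ _ _ hij,
          Matrix.blockDiagonal'_apply_ne _ _ _ (Ne.symm hij), neg_zero]
    · rintro ⟨i, a⟩ ⟨j, b⟩
      by_cases hij : i = j
      · subst hij
        have h1 := hM i a b
        by_cases hab : a = b
        · subst hab
          simpa [Matrix.blockDiagonal'_apply_eq] using h1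
        · simpa [Matrix.blockDiagonal'_apply_eq, Matrix.diagonal_apply_ne _ hab,
            Matrix.diagonal_apply_ne _ (show (⟨i, a⟩ : Σ i, Fin (n i)) ≠ ⟨i, b⟩ by simpa using hab)]
            using h1
      · rw [Matrix.sub_apply, Matrix.blockDiagonal'_apply_ne _ _ _ hij,
          Matrix.blockDiagonal'_apply_ne _ _ _ hij,
          Matrix.diagonal_apply_ne _ (fun h => hij (congrArg Sigma.fst h))]
        simpa using mul_nonneg hδ.le (hp i a).le

theorem IsNearlyNormal.reindex {ι κ : Type*} [DecidableEq ι] [DecidableEq κ] {D : Matrix ι ι ℝ}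
    {lam : ι → ℝ} (h : IsNearlyNormal D lam) (e : ι ≃ κ) :
    IsNearlyNormal (D.reindex e e) (lam ∘ e.symm) := by
  refine ⟨fun i j hij => h.eq_of_ne_zero _ _ hij, fun δ hδ => ?_⟩
  obtain ⟨p, hp, R, hR, hM⟩ := h.nearlySkew δ hδ
  refine ⟨p ∘ e.symm, fun i => hp _, R.submatrix e.symm e.symm, fun i j => hR _ _, fun i j => ?_⟩
  have := hM (e.symm i) (e.symm j)
  by_cases hij : i = j
  · subst hij
    simpa using this
  · rw [Matrix.sub_apply, Matrix.diagonal_apply_ne _ (e.symm.injective.ne hij)] at this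
    rw [Matrix.sub_apply, Matrix.diagonal_apply_ne _ hij]
    exact this

theorem IsRealCanonicalForm.isNearlyNormal {m : ℕ} {D : Matrix (Fin m) (Fin m) ℝ}
    (h : IsRealCanonicalForm D) : IsNearlyNormal D fun i => D i i := by
  obtain ⟨k, n, B, hm, hB, rfl⟩ := h
  convert (IsNearlyNormal.blockDiagonal' fun i => (hB i).isNearlyNormal).reindex
    (finSigmaFinEquiv.trans (finCongr hm)) using 1
  ext i
  simp only [Matrix.reindex_apply, Matrix.submatrix_apply, Function.comp_apply]
  exact Matrix.blockDiagonal'_apply_eq _ _ _ _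

theorem IsNearlyNormal.add_smul_one {ι : Type*} [DecidableEq ι] {D : Matrix ι ι ℝ}
    {lam : ι → ℝ} (h : IsNearlyNormal D lam) (c : ℝ) :
    IsNearlyNormal (D + c • (1 : Matrix ι ι ℝ)) fun i => lam i + c := by
  constructor
  · intro i j hij
    by_cases hne : i = j
    · rw [hne]
    · rw [h.eq_of_ne_zero i j]
      simpa [Matrix.one_apply_ne hne] using hij
  · have hd : D + c • (1 : Matrix ι ι ℝ) - Matrix.diagonal (fun i => lam i + c) =
        D - Matrix.diagonal lam := by
      rw [← Matrix.diagonal_add, Matrix.smul_one_eq_diagonal]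
      abel
    rw [hd]
    exact h.nearlySkew

/-- Gronwall's inequality in both time directions. -/
theorem le_exp_abs_mul_of_abs_deriv_le {g g' : ℝ → ℝ} {c : ℝ}
    (hg : ∀ s, HasDerivAt g (g' s) s) (hle : ∀ s, |g' s| ≤ c * g s) (s : ℝ) :
    g s ≤ Real.exp (c * |s|) * g 0 := by
  have hderiv : ∀ (a : ℝ) s, HasDerivAt (fun s => g s * Real.exp (a * s))
      ((g' s + a * g s) * Real.exp (a * s)) s := by
    intro a s
    have h2 : HasDerivAt (fun s : ℝ => Real.exp (a * s)) (Real.exp (a * s) * (a * 1)) s :=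
      ((hasDerivAt_id s).const_mul a).exp
    exact ((hg s).mul h2).congr_deriv (by ring)
  rcases le_total 0 s with hs | hs
  · have h : Antitone fun s => g s * Real.exp (-c * s) :=
      antitone_of_deriv_nonpos (fun s => (hderiv _ s).differentiableAt) fun s => by
        rw [(hderiv _ s).deriv]
        exact mul_nonpos_of_nonpos_of_nonneg (by linarith [(abs_le.1 (hle s)).2])
          (Real.exp_pos _).le
    have h1 : g s * Real.exp (-c * s) ≤ g 0 * Real.exp (-c * 0) := h hs
    rw [mul_zero, Real.exp_zero, mul_one, neg_mul, Real.exp_neg, ← div_eq_mul_inv,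
      div_le_iff₀ (Real.exp_pos _)] at h1
    rw [abs_of_nonneg hs]
    linarith
  · have h : Monotone fun s => g s * Real.exp (c * s) :=
      monotone_of_deriv_nonneg (fun s => (hderiv _ s).differentiableAt) fun s => by
        rw [(hderiv _ s).deriv]
        exact mul_nonneg (by linarith [(abs_le.1 (hle s)).1]) (Real.exp_pos _).le
    have h1 : g s * Real.exp (c * s) ≤ g 0 * Real.exp (c * 0) := h hs
    rw [mul_zero, Real.exp_zero, mul_one] at h1
    rw [abs_of_nonpos hs, mul_neg, Real.exp_neg, inv_mul_eq_div, le_div_iff₀ (Real.exp_pos _)]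
    exact h1

/-- A skew-symmetric matrix does not contribute to its quadratic form. -/
theorem abs_quadraticForm_le {ι : Type*} [Fintype ι] {A R : Matrix ι ι ℝ} {δ : ℝ}
    (hR : ∀ i j, R j i = -R i j) (hA : ∀ i j, |A i j - R i j| ≤ δ) (z : ι → ℝ) :
    |∑ i, ∑ j, z i * A j i * z j| ≤ δ * Fintype.card ι * ∑ i, z i ^ 2 := by
  have hskew : ∑ i, ∑ j, z i * R j i * z j = 0 := by
    have h : ∑ i, ∑ j, z i * R j i * z j = -∑ i, ∑ j, z i * R j i * z j := by
      conv_lhs => rw [Finset.sum_comm]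
      rw [← Finset.sum_neg_distrib]
      refine Finset.sum_congr rfl fun i _ => ?_
      rw [← Finset.sum_neg_distrib]
      refine Finset.sum_congr rfl fun j _ => ?_
      rw [hR j i]
      ring
    linarith
  have hsub : ∑ i, ∑ j, z i * A j i * z j = ∑ i, ∑ j, z i * (A j i - R j i) * z j := by
    rw [← sub_zero (∑ i, ∑ j, z i * A j i * z j), ← hskew, ← Finset.sum_sub_distrib]
    refine Finset.sum_congr rfl fun i _ => ?_
    rw [← Finset.sum_sub_distrib]
    exact Finset.sum_congr rfl fun j _ => by ring
  rcases isEmpty_or_nonempty ι with hι | ⟨⟨i₀⟩⟩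
  · simp
  have hδ : 0 ≤ δ := (abs_nonneg _).trans (hA i₀ i₀)
  calc |∑ i, ∑ j, z i * A j i * z j|
      ≤ ∑ i, ∑ j, |z i| * δ * |z j| := by
        rw [hsub]
        refine (Finset.abs_sum_le_sum_abs _ _).trans (Finset.sum_le_sum fun i _ => ?_)
        refine (Finset.abs_sum_le_sum_abs _ _).trans (Finset.sum_le_sum fun j _ => ?_)
        rw [abs_mul, abs_mul]
        gcongr
        exact hA j i
    _ = δ * (∑ i, |z i|) ^ 2 := by
        rw [sq, Finset.sum_mul_sum, Finset.mul_sum]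
        refine Finset.sum_congr rfl fun i _ => ?_
        rw [Finset.mul_sum]
        exact Finset.sum_congr rfl fun j _ => by ring
    _ ≤ δ * (Fintype.card ι * ∑ i, |z i| ^ 2) := by
        gcongr
        exact sq_sum_le_card_mul_sum_sq
    _ = _ := by simp only [sq_abs]; ring

/-- In real canonical form, the `j`-th coordinate of `exp (s Dᵀ) x` grows at the rate of the `j`-th
diagonal entry, up to `e ^ (ε |s|)`. The diagonal scaling of `IsNearlySkew` makes the quadratic
form of `D - diag lam` as small as desired, so no Jordan cell has to be exponentiated. -/
theorem IsNearlyNormal.exists_abs_exp_mulVec_le {m : ℕ} {D : Matrix (Fin m) (Fin m) ℝ}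
    {lam : Fin m → ℝ} (h : IsNearlyNormal D lam) {ε : ℝ} (hε : 0 < ε) :
    ∃ K : ℝ, 0 < K ∧ ∀ (s : ℝ) (x : EuclideanSpace ℝ (Fin m)) (j : Fin m),
      |(NormedSpace.exp (s • D.transpose)).mulVec x j| ≤
        K * Real.exp (s * lam j + ε * |s|) * ‖x‖ := by
  obtain ⟨p, hp, R, hR, hM⟩ := h.nearlySkew (ε / (m + 1)) (by positivity)
  have hpsum : ∀ j, p j ≤ ∑ i, p i :=
    fun j => Finset.single_le_sum (fun i _ => (hp i).le) (Finset.mem_univ j)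
  have hpinv : ∀ j, (p j)⁻¹ ≤ ∑ i, (p i)⁻¹ := fun j =>
    Finset.single_le_sum (f := fun i => (p i)⁻¹) (fun i _ => (inv_pos.2 (hp i)).le)
      (Finset.mem_univ j)
  have hS : 0 ≤ ∑ i, p i := Finset.sum_nonneg fun i _ => (hp i).le
  have hS' : 0 ≤ ∑ i, (p i)⁻¹ := Finset.sum_nonneg fun i _ => (inv_pos.2 (hp i)).le
  -- the summand `1` keeps the constant positive when `m = 0`
  refine ⟨(∑ i, (p i)⁻¹) * (∑ i, p i) + 1, by positivity, fun s x j => ?_⟩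
  set y : ℝ → Fin m → ℝ := fun s => (NormedSpace.exp (s • D.transpose)).mulVec x with hy
  set z : ℝ → Fin m → ℝ := fun s i => p i * Real.exp (-(s * lam i)) * y s i with hz
  set A : Matrix (Fin m) (Fin m) ℝ :=
    Matrix.of fun i j => (p i)⁻¹ * (D - Matrix.diagonal lam) i j * p j with hA
  have hAR : ∀ i j, |A i j - R i j| ≤ ε / (m + 1) := by
    intro i j
    have h1 : A i j - R i j = (p i)⁻¹ * ((D - Matrix.diagonal lam) i j * p j - p i * R i j) := by
      rw [hA, Matrix.of_apply, mul_sub, ← mul_assoc (p i)⁻¹ (p i), inv_mul_cancel₀ (hp i).ne',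
        one_mul]
      ring
    rw [h1, abs_mul, abs_of_pos (inv_pos.2 (hp i)), inv_mul_le_iff₀ (hp i),
      mul_comm (p i) (ε / _)]
    exact hM i j
  have hzd : ∀ s i, HasDerivAt (fun s => z s i) (∑ j, A j i * z s j) s := by
    intro s i
    have hexp : HasDerivAt (fun s : ℝ => Real.exp (-(s * lam i)))
        (Real.exp (-(s * lam i)) * -(1 * lam i)) s :=
      ((hasDerivAt_id s).mul_const (lam i)).neg.exp
    refine ((hexp.const_mul (p i)).mul
      (hasDerivAt_exp_smul_mulVec D.transpose x s i)).congr_deriv ?_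
    change p i * (Real.exp (-(s * lam i)) * -(1 * lam i)) * y s i +
      p i * Real.exp (-(s * lam i)) * D.transpose.mulVec (y s) i = _
    have hdiag : lam i * y s i = ∑ j, Matrix.diagonal lam j i * y s j := by
      rw [Finset.sum_eq_single i] <;> simp +contextual [Matrix.diagonal_apply_ne]
    have hmul : D.transpose.mulVec (y s) i = ∑ j, D j i * y s j := rfl
    calc _ = p i * Real.exp (-(s * lam i)) *
          (D.transpose.mulVec (y s) i - lam i * y s i) := by ring
      _ = ∑ j, p i * Real.exp (-(s * lam i)) *
          ((D - Matrix.diagonal lam) j i * y s j) := by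
        rw [hmul, hdiag, ← Finset.sum_sub_distrib, Finset.mul_sum]
        exact Finset.sum_congr rfl fun j _ => by rw [Matrix.sub_apply]; ring
      _ = _ := by
        refine Finset.sum_congr rfl fun j _ => ?_
        rw [hA, hz, Matrix.of_apply]
        by_cases hji : (D - Matrix.diagonal lam) j i = 0
        · simp [hji]
        · have hlam : lam j = lam i := by
            by_cases hne : j = i
            · rw [hne]
            · apply h.eq_of_ne_zero
              simpa [Matrix.diagonal_apply_ne _ hne] using hji
          simp only [hlam]
          field_simp [(hp j).ne']
  have hg : ∀ s, HasDerivAt (fun s => ∑ i, z s i ^ 2)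
      (2 * ∑ i, ∑ j, z s i * A j i * z s j) s := by
    intro s
    refine (HasDerivAt.fun_sum fun i _ => (hzd s i).pow 2).congr_deriv ?_
    rw [Finset.mul_sum]
    refine Finset.sum_congr rfl fun i _ => ?_
    rw [Finset.mul_sum, Finset.mul_sum]
    refine Finset.sum_congr rfl fun j _ => ?_
    push_cast
    ring
  have hgrow := le_exp_abs_mul_of_abs_deriv_le (c := 2 * ε) hg (fun s => by
    rw [abs_mul, abs_two, mul_assoc]
    refine mul_le_mul_of_nonneg_left ((abs_quadraticForm_le hR hAR (z s)).trans ?_) two_pos.le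
    rw [Fintype.card_fin]
    refine mul_le_mul_of_nonneg_right ?_ (Finset.sum_nonneg fun i _ => sq_nonneg _)
    rw [div_mul_eq_mul_div, div_le_iff₀ (by positivity)]
    nlinarith) s
  have hg0 : ∑ i, z 0 i ^ 2 ≤ ((∑ i, p i) * ‖x‖) ^ 2 := by
    rw [mul_pow, EuclideanSpace.real_norm_sq_eq, Finset.mul_sum]
    refine Finset.sum_le_sum fun i _ => ?_
    simp only [hz, hy, zero_mul, neg_zero, Real.exp_zero, mul_one, zero_smul,
      NormedSpace.exp_zero, Matrix.one_mulVec, mul_pow]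
    gcongr
    · exact (hp i).le
    · exact hpsum i
  have hzj : |z s j| ≤ Real.exp (ε * |s|) * ((∑ i, p i) * ‖x‖) := by
    refine abs_le_of_sq_le_sq ?_ (by positivity)
    calc z s j ^ 2 ≤ ∑ i, z s i ^ 2 :=
          Finset.single_le_sum (f := fun i => z s i ^ 2) (fun i _ => sq_nonneg _)
            (Finset.mem_univ j)
      _ ≤ Real.exp (2 * ε * |s|) * ((∑ i, p i) * ‖x‖) ^ 2 := hgrow.trans (by gcongr)
      _ = _ := by
        rw [mul_pow (Real.exp _), ← Real.exp_nat_mul]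
        push_cast
        ring_nf
  have hyz : |y s j| = (p j)⁻¹ * Real.exp (s * lam j) * |z s j| := by
    rw [hz, abs_mul, abs_mul, abs_of_pos (hp j), Real.abs_exp, Real.exp_neg]
    field_simp [(hp j).ne']
  change |y s j| ≤ _
  rw [hyz, Real.exp_add]
  calc (p j)⁻¹ * Real.exp (s * lam j) * |z s j|
      ≤ (∑ i, (p i)⁻¹) * Real.exp (s * lam j) *
        (Real.exp (ε * |s|) * ((∑ i, p i) * ‖x‖)) := by
        gcongr
        exact hpinv j
    _ = (∑ i, (p i)⁻¹) * (∑ i, p i) * (Real.exp (s * lam j) * Real.exp (ε * |s|)) * ‖x‖ := by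
        ring
    _ ≤ _ := by
        gcongr
        linarith

/-! ### The characteristic function of a stochastic integral -/

theorem toEuclideanCLM_conjTranspose {n : ℕ} (A : Matrix (Fin n) (Fin n) ℂ) :
    Matrix.toEuclideanCLM (n := Fin n) (𝕜 := ℂ) A.conjTranspose =
      ContinuousLinearMap.adjoint (Matrix.toEuclideanCLM (n := Fin n) (𝕜 := ℂ) A) := by
  rw [← ContinuousLinearMap.star_eq_adjoint, ← Matrix.star_eq_conjTranspose, map_star]

theorem inner_matAct {n : ℕ} (A : Matrix (Fin n) (Fin n) ℂ) (x y : EuclideanSpace ℂ (Fin n)) :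
    inner ℂ x (matAct A y) = inner ℂ (matAct A.conjTranspose x) y := by
  rw [matAct, matAct, toEuclideanCLM_conjTranspose, ContinuousLinearMap.adjoint_inner_left]

theorem enorm_matAct_conjTranspose_le {n : ℕ} (A : Matrix (Fin n) (Fin n) ℂ)
    (x : EuclideanSpace ℂ (Fin n)) : ‖matAct A.conjTranspose x‖ₑ ≤ opENorm A * ‖x‖ₑ := by
  have h : ‖Matrix.toEuclideanCLM (n := Fin n) (𝕜 := ℂ) A.conjTranspose‖ₑ = opENorm A := by
    rw [toEuclideanCLM_conjTranspose, opENorm, ← ofReal_norm, ← ofReal_norm,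
      LinearIsometryEquiv.norm_map]
  rw [← h]
  exact ContinuousLinearMap.le_opENorm _ _

theorem ENNReal.add_rpow_le_two_rpow_mul {α : ℝ} (hα : 0 ≤ α) (a b : ENNReal) :
    (a + b) ^ α ≤ 2 ^ α * (a ^ α + b ^ α) := by
  calc (a + b) ^ α ≤ (2 * max a b) ^ α := by
        gcongr
        rw [two_mul]
        exact add_le_add (le_max_left _ _) (le_max_right _ _)
    _ = 2 ^ α * max a b ^ α := ENNReal.mul_rpow_of_nonneg _ _ hα
    _ ≤ _ := by
        gcongr
        rcases max_cases a b with ⟨h, -⟩ | ⟨h, -⟩ <;> rw [h]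
        · exact le_self_add
        · exact le_add_self

section StochasticIntegral

variable {Ω : Type*} {d m : ℕ} {α : ℝ}
  {W : Set (EuclideanSpace ℝ (Fin d)) → Ω → EuclideanSpace ℂ (Fin m)}

open Classical in
/-- The exponent `∑_{R ≠ 0} |{S = R}| ‖Rᴴ ζ‖ ^ α` in the characteristic function of the integral of
the simple function `S`; it equals `∫ ‖S(u)ᴴ ζ‖ ^ α du`. -/
noncomputable def stableExponent (α : ℝ)
    (S : SimpleFunc (EuclideanSpace ℝ (Fin d)) (Matrix (Fin m) (Fin m) ℂ))
    (ζ : EuclideanSpace ℂ (Fin m)) : ℝ :=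
  ∑ R ∈ S.range with R ≠ 0, (volume (S ⁻¹' {R})).toReal * ‖matAct R.conjTranspose ζ‖ ^ α

theorem stableExponent_nonneg
    (S : SimpleFunc (EuclideanSpace ℝ (Fin d)) (Matrix (Fin m) (Fin m) ℂ))
    (ζ : EuclideanSpace ℂ (Fin m)) : 0 ≤ stableExponent α S ζ :=
  Finset.sum_nonneg fun R _ => by positivity

open Classical in
/-- The value `0`, whose level set has infinite measure, may be dropped from the integral. -/
theorem simpleIntegral_eq_sum_filter
    (S : SimpleFunc (EuclideanSpace ℝ (Fin d)) (Matrix (Fin m) (Fin m) ℂ)) (ω : Ω) :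
    simpleIntegral W S ω = ∑ R ∈ S.range with R ≠ 0, matAct R (W (S ⁻¹' {R}) ω) := by
  rw [simpleIntegral, Finset.sum_filter_of_ne]
  rintro R - hR rfl
  exact hR (by simp [matAct])

variable [MeasurableSpace Ω] {P : Measure Ω}

open Classical in
theorem IsIsotropicStableMeasure.measurable_simpleIntegral (hW : IsIsotropicStableMeasure P α W)
    {S : SimpleFunc (EuclideanSpace ℝ (Fin d)) (Matrix (Fin m) (Fin m) ℂ)}
    (hS : S.FinMeasSupp volume) : Measurable (simpleIntegral W S) := by
  have h : simpleIntegral W S =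
      fun ω => ∑ R ∈ S.range with R ≠ 0, matAct R (W (S ⁻¹' {R}) ω) :=
    funext (simpleIntegral_eq_sum_filter S)
  rw [h]
  refine Finset.measurable_fun_sum _ fun R hR => ?_
  exact (ContinuousLinearMap.continuous _).measurable.comp
    (hW.measurable _ (S.measurableSet_fiber R)
      (hS.meas_preimage_singleton_ne_zero (Finset.mem_filter.1 hR).2))

open Classical in
theorem IsIsotropicStableMeasure.integral_exp_simpleIntegral
    (hW : IsIsotropicStableMeasure P α W)
    {S : SimpleFunc (EuclideanSpace ℝ (Fin d)) (Matrix (Fin m) (Fin m) ℂ)}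
    (hS : S.FinMeasSupp volume) (ζ : EuclideanSpace ℂ (Fin m)) :
    ∫ ω, Complex.exp (Complex.I * ((inner ℂ ζ (simpleIntegral W S ω)).re : ℂ)) ∂P =
      (Real.exp (-stableExponent α S ζ) : ℂ) := by
  rw [stableExponent]
  set F := S.range.filter (· ≠ 0)
  have hfin : ∀ R ∈ F, volume (S ⁻¹' {R}) < ⊤ := fun R hR =>
    hS.meas_preimage_singleton_ne_zero (Finset.mem_filter.1 hR).2
  let e := F.equivFin.symm
  have hind : iIndepFun (fun i => W (S ⁻¹' {(e i : Matrix (Fin m) (Fin m) ℂ)})) P := by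
    refine hW.indep _ _ (fun i => S.measurableSet_fiber _) (fun i => hfin _ (e i).2) ?_
    intro i j hij
    refine Disjoint.preimage _ (Set.disjoint_singleton.2 fun h => hij ?_)
    exact e.injective (Subtype.ext h)
  have hsum : ∀ ω, Complex.exp (Complex.I * ((inner ℂ ζ (simpleIntegral W S ω)).re : ℂ)) =
      ∏ i, Complex.exp (Complex.I * ((inner ℂ
        (matAct (e i : Matrix (Fin m) (Fin m) ℂ).conjTranspose ζ)
        (W (S ⁻¹' {(e i : Matrix (Fin m) (Fin m) ℂ)}) ω)).re : ℂ)) := by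
    intro ω
    rw [simpleIntegral_eq_sum_filter, inner_sum, Complex.re_sum, Complex.ofReal_sum,
      Finset.mul_sum, Complex.exp_sum, e.prod_comp (fun R : F => Complex.exp (Complex.I *
        ((inner ℂ (matAct (R : Matrix (Fin m) (Fin m) ℂ).conjTranspose ζ)
          (W (S ⁻¹' {(R : Matrix (Fin m) (Fin m) ℂ)}) ω)).re : ℂ))),
      Finset.prod_coe_sort F (fun R => Complex.exp (Complex.I *
        ((inner ℂ (matAct R.conjTranspose ζ) (W (S ⁻¹' {R}) ω)).re : ℂ)))]
    exact Finset.prod_congr rfl fun R _ => by rw [inner_matAct]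
  simp_rw [hsum]
  rw [hind.integral_fun_prod_comp
    (f := fun i w => Complex.exp (Complex.I * ((inner ℂ
        (matAct (e i : Matrix (Fin m) (Fin m) ℂ).conjTranspose ζ) w).re : ℂ)))
    (fun i => (hW.measurable _ (S.measurableSet_fiber _) (hfin _ (e i).2)).aemeasurable)
    (fun i => (by fun_prop : Continuous _).aestronglyMeasurable)]
  simp_rw [fun i => hW.charFun _ (S.measurableSet_fiber (e i : Matrix (Fin m) (Fin m) ℂ))
    (hfin _ (e i).2) (matAct (e i : Matrix (Fin m) (Fin m) ℂ).conjTranspose ζ)]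
  rw [e.prod_comp (fun R : F => (Real.exp (-((volume (S ⁻¹' {(R : Matrix _ _ ℂ)})).toReal *
      ‖matAct (R : Matrix (Fin m) (Fin m) ℂ).conjTranspose ζ‖ ^ α)) : ℂ)),
    Finset.prod_coe_sort F (fun R => (Real.exp (-((volume (S ⁻¹' {R})).toReal *
      ‖matAct R.conjTranspose ζ‖ ^ α)) : ℂ)), ← Complex.ofReal_prod, ← Real.exp_sum,
    Finset.sum_neg_distrib]

open Classical in
theorem lintegral_matAct_simpleFunc (hα : 0 < α)
    {S : SimpleFunc (EuclideanSpace ℝ (Fin d)) (Matrix (Fin m) (Fin m) ℂ)}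
    (hS : S.FinMeasSupp volume) (ζ : EuclideanSpace ℂ (Fin m)) :
    ∫⁻ u, ‖matAct (S u).conjTranspose ζ‖ₑ ^ α = ENNReal.ofReal (stableExponent α S ζ) := by
  rw [stableExponent]
  have h := (S.map fun R => ‖matAct R.conjTranspose ζ‖ₑ ^ α).lintegral_eq_lintegral volume
  simp only [SimpleFunc.coe_map, Function.comp_def] at h
  rw [h, SimpleFunc.map_lintegral, ENNReal.ofReal_sum_of_nonneg fun R _ => by positivity]
  rw [← Finset.sum_filter_of_ne (p := (· ≠ 0))]
  · refine Finset.sum_congr rfl fun R hR => ?_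
    rw [ENNReal.ofReal_mul ENNReal.toReal_nonneg, ENNReal.ofReal_toReal
      (hS.meas_preimage_singleton_ne_zero (Finset.mem_filter.1 hR).2).ne, mul_comm,
      ← ENNReal.ofReal_rpow_of_nonneg (norm_nonneg _) hα.le, ofReal_norm]
  · rintro R - hR rfl
    exact hR (by simp [matAct, hα])

theorem enorm_matAct_rpow_le (hα : 0 < α) (A B : Matrix (Fin m) (Fin m) ℂ)
    (ζ : EuclideanSpace ℂ (Fin m)) :
    ‖matAct B.conjTranspose ζ‖ₑ ^ α ≤
      2 ^ α * (‖matAct A.conjTranspose ζ‖ₑ ^ α + ‖ζ‖ₑ ^ α * opENorm (A - B) ^ α) := by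
  have hsub : matAct B.conjTranspose ζ =
      matAct A.conjTranspose ζ - matAct (A - B).conjTranspose ζ := by
    simp [matAct, Matrix.conjTranspose_sub, map_sub]
  have h : ‖matAct B.conjTranspose ζ‖ₑ ≤
      ‖matAct A.conjTranspose ζ‖ₑ + ‖ζ‖ₑ * opENorm (A - B) := by
    rw [hsub, mul_comm]
    exact enorm_sub_le.trans (add_le_add_right (enorm_matAct_conjTranspose_le _ _) _)
  rw [← ENNReal.mul_rpow_of_nonneg _ _ hα.le]
  exact (ENNReal.rpow_le_rpow h hα.le).trans (ENNReal.add_rpow_le_two_rpow_mul hα.le _ _)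

theorem lintegral_matAct_le (hα : 0 < α)
    {S : SimpleFunc (EuclideanSpace ℝ (Fin d)) (Matrix (Fin m) (Fin m) ℂ)}
    (hS : S.FinMeasSupp volume) (Q : EuclideanSpace ℝ (Fin d) → Matrix (Fin m) (Fin m) ℂ)
    (ζ : EuclideanSpace ℂ (Fin m)) :
    ∫⁻ u, ‖matAct (Q u).conjTranspose ζ‖ₑ ^ α ≤
      2 ^ α * (ENNReal.ofReal (stableExponent α S ζ) +
        ‖ζ‖ₑ ^ α * ∫⁻ u, opENorm (S u - Q u) ^ α) := by
  have hK : (2 : ENNReal) ^ α ≠ ⊤ := ENNReal.rpow_ne_top_of_nonneg hα.le (by simp)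
  have hζ : ‖ζ‖ₑ ^ α ≠ ⊤ := ENNReal.rpow_ne_top_of_nonneg hα.le (by simp)
  have hmeas : Measurable fun u => ‖matAct (S u).conjTranspose ζ‖ₑ ^ α := by
    simpa only [SimpleFunc.coe_map, Function.comp_def] using
      (S.map fun R => ‖matAct R.conjTranspose ζ‖ₑ ^ α).measurable
  rw [← lintegral_matAct_simpleFunc hα hS ζ, ← lintegral_const_mul' _ _ hζ,
    ← lintegral_add_left hmeas, ← lintegral_const_mul' _ _ hK]
  exact lintegral_mono fun u => enorm_matAct_rpow_le hα (S u) (Q u) ζ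

/-- The characteristic function of `∫ Q dW` is real, and at most
`exp (-2 ^ (-α) ∫ ‖Q(u)ᴴ ζ‖ ^ α du)`. The exact value has the constant `1` in place of `2 ^ (-α)`;
the weaker constant comes from a triangle inequality for the `α`-th power that spares all
measurability considerations on `Q`, and is immaterial here. -/
theorem IsStochasticIntegral.exists_integral_exp_eq [IsProbabilityMeasure P] (hα : 0 < α)
    (hW : IsIsotropicStableMeasure P α W)
    {Q : EuclideanSpace ℝ (Fin d) → Matrix (Fin m) (Fin m) ℂ} {Y : Ω → EuclideanSpace ℂ (Fin m)}
    (hY : IsStochasticIntegral P α W Q Y) (ζ : EuclideanSpace ℂ (Fin m)) {c : ℝ}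
    (hc : ENNReal.ofReal c ≤ ∫⁻ u, ‖matAct (Q u).conjTranspose ζ‖ₑ ^ α) :
    ∃ L : ℝ, ∫ ω, Complex.exp (Complex.I * ((inner ℂ ζ (Y ω)).re : ℂ)) ∂P = (L : ℂ) ∧
      L ≤ Real.exp (-(c / 2 ^ α)) := by
  obtain ⟨S, hS, hSQ, hSY⟩ := hY
  obtain ⟨ns, hns, hae⟩ := hSY.exists_seq_tendsto_ae
  set a : ℕ → ℝ := fun n => stableExponent α (S n) ζ with ha
  have ha0 : ∀ n, 0 ≤ a n := fun n => stableExponent_nonneg _ _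
  have hlim : Tendsto (fun k => (Real.exp (-a (ns k)) : ℂ)) atTop
      (𝓝 (∫ ω, Complex.exp (Complex.I * ((inner ℂ ζ (Y ω)).re : ℂ)) ∂P)) := by
    simp_rw [ha, ← fun k => hW.integral_exp_simpleIntegral (hS (ns k)) ζ]
    refine tendsto_integral_of_dominated_convergence (fun _ => 1)
      (fun k => ?_) (integrable_const _) (fun k => ae_of_all _ fun ω => ?_) ?_
    · have hcont : Continuous fun w : EuclideanSpace ℂ (Fin m) =>
          Complex.exp (Complex.I * ((inner ℂ ζ w).re : ℂ)) := by fun_prop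
      exact (hcont.measurable.comp
        (hW.measurable_simpleIntegral (hS (ns k)))).aestronglyMeasurable
    · rw [mul_comm, Complex.norm_exp_ofReal_mul_I]
    · filter_upwards [hae] with ω hω
      have hcont : Continuous fun w : EuclideanSpace ℂ (Fin m) =>
          Complex.exp (Complex.I * ((inner ℂ ζ w).re : ℂ)) := by fun_prop
      exact (hcont.tendsto _).comp hω
  set L := ∫ ω, Complex.exp (Complex.I * ((inner ℂ ζ (Y ω)).re : ℂ)) ∂P
  have hre : Tendsto (fun k => Real.exp (-a (ns k))) atTop (𝓝 L.re) := by
    simpa only [Function.comp_def, Complex.ofReal_re] using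
      (Complex.continuous_re.tendsto L).comp hlim
  have him : Tendsto (fun _ : ℕ => (0 : ℝ)) atTop (𝓝 L.im) := by
    simpa only [Function.comp_def, Complex.ofReal_im] using
      (Complex.continuous_im.tendsto _).comp hlim
  have him0 : L.im = 0 := tendsto_nhds_unique him tendsto_const_nhds
  refine ⟨L.re, Complex.ext (by simp) (by simp [him0]), ?_⟩
  set e : ℕ → ENNReal := fun n => ∫⁻ u, opENorm (S n u - Q u) ^ α with he
  have hζ : ‖ζ‖ₑ ^ α ≠ ⊤ := ENNReal.rpow_ne_top_of_nonneg hα.le (by simp)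
  have hbound : ∀ n, ENNReal.ofReal c ≤
      2 ^ α * (ENNReal.ofReal (a n) + ‖ζ‖ₑ ^ α * e n) :=
    fun n => hc.trans (lintegral_matAct_le hα (hS n) Q ζ)
  have hb : Tendsto (fun n => (‖ζ‖ₑ ^ α * e n).toReal) atTop (𝓝 0) := by
    have h := ENNReal.Tendsto.const_mul hSQ (Or.inr hζ)
    rw [mul_zero] at h
    exact (ENNReal.tendsto_toReal ENNReal.zero_ne_top).comp h
  have hle : ∀ᶠ n in atTop,
      Real.exp (-a n) ≤ Real.exp (-(c / 2 ^ α - (‖ζ‖ₑ ^ α * e n).toReal)) := by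
    filter_upwards [hSQ.eventually_lt_const ENNReal.zero_lt_top] with n hn
    have hfin : ‖ζ‖ₑ ^ α * e n ≠ ⊤ := ENNReal.mul_ne_top hζ hn.ne
    have h := hbound n
    rw [← ENNReal.ofReal_toReal hfin, ← ENNReal.ofReal_add (ha0 n) ENNReal.toReal_nonneg,
      show (2 : ENNReal) ^ α = ENNReal.ofReal (2 ^ α) by
        rw [← ENNReal.ofReal_rpow_of_pos two_pos]; simp,
      ← ENNReal.ofReal_mul (by positivity), ENNReal.ofReal_le_ofReal_iff
        (mul_nonneg (by positivity) (add_nonneg (ha0 n) ENNReal.toReal_nonneg))] at h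
    have h2 : c / 2 ^ α ≤ a n + (‖ζ‖ₑ ^ α * e n).toReal := by
      rw [div_le_iff₀ (by positivity)]
      linarith
    exact Real.exp_le_exp.2 (by linarith)
  have hr : Tendsto (fun n => Real.exp (-(c / 2 ^ α - (‖ζ‖ₑ ^ α * e n).toReal))) atTop
      (𝓝 (Real.exp (-(c / 2 ^ α)))) := by
    have h : Continuous fun b : ℝ => Real.exp (-(c / 2 ^ α - b)) := by fun_prop
    simpa [Function.comp_def] using (h.tendsto 0).comp hb
  exact le_of_tendsto_of_tendsto hre (hr.comp hns.tendsto_atTop)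
    (hns.tendsto_atTop.eventually hle)

end StochasticIntegral

/-! ### A lower bound for the exponent of the harmonizable field -/

theorem matPow_eq_exp {n : ℕ} (c : ℝ) (A : Matrix (Fin n) (Fin n) ℝ) :
    matPow c A = NormedSpace.exp (Real.log c • A) := rfl

theorem transpose_matPow {n : ℕ} (c : ℝ) (A : Matrix (Fin n) (Fin n) ℝ) :
    (matPow c A).transpose = matPow c A.transpose := by
  rw [matPow, matPow, ← Matrix.exp_transpose, Matrix.transpose_smul]

theorem inner_matAct_left {n : ℕ} (A : Matrix (Fin n) (Fin n) ℝ)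
    (x y : EuclideanSpace ℝ (Fin n)) :
    inner ℝ (matAct A x) y = inner ℝ x (matAct A.transpose y) := by
  have h : A.transpose = star A := by
    rw [Matrix.star_eq_conjTranspose, Matrix.conjTranspose_eq_transpose_of_trivial]
  rw [matAct, matAct, h, map_star, ContinuousLinearMap.star_eq_adjoint,
    ContinuousLinearMap.adjoint_inner_right]

theorem volume_preimage_matAct_matPow {d : ℕ} (E : Matrix (Fin d) (Fin d) ℝ) {r : ℝ} (hr : 0 < r)
    (s : Set (EuclideanSpace ℝ (Fin d))) :
    volume (matAct (matPow r E) ⁻¹' s) = ENNReal.ofReal (r ^ (-E.trace)) * volume s := by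
  have hdet : LinearMap.det ((Matrix.toEuclideanCLM (n := Fin d) (𝕜 := ℝ) (matPow r E) :
      EuclideanSpace ℝ (Fin d) →L[ℝ] EuclideanSpace ℝ (Fin d)) :
      EuclideanSpace ℝ (Fin d) →ₗ[ℝ] EuclideanSpace ℝ (Fin d)) = r ^ E.trace := by
    rw [Matrix.coe_toEuclideanCLM_eq_toEuclideanLin, Real.rpow_def_of_pos hr, ← det_exp_smul]
    exact LinearMap.det_toLpLin _ _
  have hpos : 0 < r ^ E.trace := Real.rpow_pos_of_pos hr _
  have h := Measure.addHaar_preimage_continuousLinearMap volume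
    (f := Matrix.toEuclideanCLM (n := Fin d) (𝕜 := ℝ) (matPow r E)) (by rw [hdet]; exact hpos.ne') s
  rw [hdet, abs_of_pos (inv_pos.2 hpos), ← Real.rpow_neg hr.le] at h
  exact h

/-- A real vector, seen as a complex one. -/
def toComplexVec {m : ℕ} (θ : EuclideanSpace ℝ (Fin m)) : EuclideanSpace ℂ (Fin m) :=
  WithLp.toLp 2 fun j => (θ j : ℂ)

theorem norm_toComplexVec {m : ℕ} (θ : EuclideanSpace ℝ (Fin m)) : ‖toComplexVec θ‖ = ‖θ‖ := by
  simp [EuclideanSpace.norm_eq, toComplexVec]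

theorem norm_matAct_harmonizableKernel {d m : ℕ} (α : ℝ) (E : Matrix (Fin d) (Fin d) ℝ)
    (D : Matrix (Fin m) (Fin m) ℝ) (ψ : EuclideanSpace ℝ (Fin d) → ℝ)
    (t y : EuclideanSpace ℝ (Fin d)) (θ : EuclideanSpace ℝ (Fin m)) :
    ‖matAct (harmonizableKernel α E D ψ t y).conjTranspose (toComplexVec θ)‖ =
      ‖Complex.exp (Complex.I * (inner ℝ t y : ℝ)) - 1‖ *
        ‖matAct (matPow (ψ y) (-D - (E.trace / α) • (1 : Matrix (Fin m) (Fin m) ℝ))).transpose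
          θ‖ := by
  set M := matPow (ψ y) (-D - (E.trace / α) • (1 : Matrix (Fin m) (Fin m) ℝ)) with hM
  set c := Complex.exp (Complex.I * (inner ℝ t y : ℝ)) - 1 with hc
  have h : matAct (harmonizableKernel α E D ψ t y).conjTranspose (toComplexVec θ) =
      star c • toComplexVec (matAct M.transpose θ) := by
    ext j
    change ((harmonizableKernel α E D ψ t y).conjTranspose.mulVec (toComplexVec θ)) j =
      star c * ((M.transpose.mulVec θ j : ℝ) : ℂ)
    simp only [harmonizableKernel, ← hM, ← hc, Matrix.mulVec, dotProduct,
      Matrix.conjTranspose_apply, Matrix.smul_apply, Matrix.map_apply, Matrix.transpose_apply,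
      toComplexVec, smul_eq_mul, star_mul', Complex.ofReal_sum, Complex.ofReal_mul, Finset.mul_sum]
    refine Finset.sum_congr rfl fun i _ => ?_
    simp [mul_assoc]
  rw [h, norm_smul, norm_star, norm_toComplexVec]

/-- The coordinates of `θ` are controlled by `e ^ (-s (Dᵀ + κ)) θ`. -/
theorem IsNearlyNormal.exists_abs_le {m : ℕ} {D : Matrix (Fin m) (Fin m) ℝ} {lam : Fin m → ℝ}
    (h : IsNearlyNormal D lam) (κ : ℝ) {ε : ℝ} (hε : 0 < ε) :
    ∃ K : ℝ, 0 < K ∧ ∀ (s : ℝ) (θ : EuclideanSpace ℝ (Fin m)) (j : Fin m),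
      |θ j| ≤ K * Real.exp (s * (lam j + κ) + ε * |s|) *
        ‖matAct (NormedSpace.exp (s • (-D - κ • (1 : Matrix (Fin m) (Fin m) ℝ)))).transpose θ‖ := by
  obtain ⟨K, hK, hle⟩ := (h.add_smul_one κ).exists_abs_exp_mulVec_le hε
  refine ⟨K, hK, fun s θ j => ?_⟩
  set G := D + κ • (1 : Matrix (Fin m) (Fin m) ℝ)
  have hG : (NormedSpace.exp (s • (-D - κ • (1 : Matrix (Fin m) (Fin m) ℝ)))).transpose =
      NormedSpace.exp ((-s) • G.transpose) := by
    rw [← Matrix.exp_transpose, neg_smul, ← smul_neg, ← Matrix.transpose_neg, Matrix.transpose_smul,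
      neg_add']
  rw [hG]
  have h1 := hle s (matAct (NormedSpace.exp ((-s) • G.transpose)) θ) j
  have h2 : (NormedSpace.exp (s • G.transpose)).mulVec
      (matAct (NormedSpace.exp ((-s) • G.transpose)) θ) = θ := by
    have h3 := exp_neg_smul_mul G.transpose (-s)
    rw [neg_neg] at h3
    change (NormedSpace.exp (s • G.transpose)).mulVec
      ((NormedSpace.exp ((-s) • G.transpose)).mulVec θ) = θ
    rw [Matrix.mulVec_mulVec, h3, Matrix.one_mulVec]
  rwa [h2] at h1

theorem Seminorm.exists_le_mul_norm {d : ℕ} (N : Seminorm ℝ (EuclideanSpace ℝ (Fin d))) :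
    ∃ c : ℝ, 0 < c ∧ ∀ x, N x ≤ c * ‖x‖ := by
  refine ⟨∑ i, N (EuclideanSpace.single i 1) + 1,
    add_pos_of_nonneg_of_pos (Finset.sum_nonneg fun i _ => apply_nonneg N _) one_pos, fun x => ?_⟩
  have hx : x = ∑ i, x i • EuclideanSpace.single i (1 : ℝ) := by
    ext j
    simp [Finset.sum_apply, Pi.single_apply]
  calc N x ≤ ∑ i, N (x i • EuclideanSpace.single i (1 : ℝ)) := by
        conv_lhs => rw [hx]
        exact Finset.le_sum_of_subadditive N (map_zero N).le (map_add_le_add N) _ _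
    _ ≤ ∑ i, ‖x‖ * N (EuclideanSpace.single i 1) := by
        refine Finset.sum_le_sum fun i _ => ?_
        rw [map_smul_eq_mul]
        gcongr
        exact PiLp.norm_apply_le x i
    _ ≤ _ := by
        rw [← Finset.mul_sum, mul_comm]
        gcongr
        linarith

theorem Seminorm.exists_norm_le_mul {d : ℕ} {N : Seminorm ℝ (EuclideanSpace ℝ (Fin d))}
    (hN : ∀ x, N x = 0 → x = 0) : ∃ c : ℝ, 0 < c ∧ ∀ x, ‖x‖ ≤ c * N x := by
  have hcont : Continuous N := by
    obtain ⟨c, hc, hle⟩ := N.exists_le_mul_norm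
    refine Seminorm.continuous_of_le (q := c.toNNReal • normSeminorm ℝ _) ?_ fun x => ?_
    · change Continuous fun x : EuclideanSpace ℝ (Fin d) => c.toNNReal • ‖x‖
      fun_prop
    · change N x ≤ c.toNNReal • ‖x‖
      rw [NNReal.smul_def, Real.coe_toNNReal _ hc.le]
      exact hle x
  rcases (Metric.sphere (0 : EuclideanSpace ℝ (Fin d)) 1).eq_empty_or_nonempty with h | h
  · refine ⟨1, one_pos, fun x => ?_⟩
    by_cases hx : x = 0
    · simp [hx]
    · have : ‖x‖⁻¹ • x ∈ Metric.sphere (0 : EuclideanSpace ℝ (Fin d)) 1 := by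
        simp [norm_smul, hx]
      rw [h] at this
      exact this.elim
  · obtain ⟨x₀, hx₀, hmin⟩ := (isCompact_sphere _ _).exists_isMinOn h hcont.continuousOn
    have hpos : 0 < N x₀ := lt_of_le_of_ne (apply_nonneg N _) fun h0 => by
      have h1 := hN x₀ h0.symm
      simp [h1] at hx₀
    refine ⟨(N x₀)⁻¹, inv_pos.2 hpos, fun x => ?_⟩
    by_cases hx : x = 0
    · simp [hx]
    · have hm : ‖x‖⁻¹ • x ∈ Metric.sphere (0 : EuclideanSpace ℝ (Fin d)) 1 := by
        simp [norm_smul, hx]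
      have h1 : N x₀ ≤ N (‖x‖⁻¹ • x) := hmin hm
      rw [map_smul_eq_mul, norm_inv, norm_norm, le_inv_mul_iff₀ (norm_pos_iff.2 hx)] at h1
      rw [le_inv_mul_iff₀ hpos, mul_comm]
      exact h1

theorem one_div_pi_le_norm_exp_sub_one {x : ℝ} (hx : 1 / 2 ≤ x) (hx' : x ≤ 3 / 2) :
    1 / Real.pi ≤ ‖Complex.exp (Complex.I * (x : ℂ)) - 1‖ := by
  have him : (Complex.exp (Complex.I * (x : ℂ)) - 1).im = Real.sin x := by
    rw [mul_comm, Complex.sub_im, Complex.exp_ofReal_mul_I_im, Complex.one_im, sub_zero]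
  have h := Real.mul_le_sin (by linarith : 0 ≤ x) (by linarith [Real.pi_gt_three])
  calc 1 / Real.pi ≤ 2 / Real.pi * x := by
        rw [div_mul_eq_mul_div, div_le_div_iff_of_pos_right Real.pi_pos]
        linarith
    _ ≤ Real.sin x := h
    _ ≤ |(Complex.exp (Complex.I * (x : ℂ)) - 1).im| := by rw [him]; exact le_abs_self _
    _ ≤ _ := Complex.abs_im_le_norm _

theorem IsHomogeneousWeight.exists_abs_log_le {d : ℕ} {E : Matrix (Fin d) (Fin d) ℝ}
    {ψ : EuclideanSpace ℝ (Fin d) → ℝ} (hψ : IsHomogeneousWeight E ψ) {a : ℝ} (ha : 0 < a)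
    (b : ℝ) : ∃ L : ℝ, ∀ z, a ≤ ‖z‖ → ‖z‖ ≤ b → |Real.log (ψ z)| ≤ L := by
  have hcomp : IsCompact {z : EuclideanSpace ℝ (Fin d) | a ≤ ‖z‖ ∧ ‖z‖ ≤ b} := by
    refine (isCompact_closedBall (0 : EuclideanSpace ℝ (Fin d)) b).of_isClosed_subset
      ((isClosed_le continuous_const continuous_norm).inter
        (isClosed_le continuous_norm continuous_const)) fun z hz => ?_
    simpa using hz.2
  obtain ⟨L, hL⟩ := hcomp.exists_bound_of_continuousOn
    (f := fun z => Real.log (ψ z)) (hψ.continuous.continuousOn.log fun z hz =>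
      hψ.ne_zero z (norm_pos_iff.1 (ha.trans_le hz.1)))
  exact ⟨L, fun z h1 h2 => hL z ⟨h1, h2⟩⟩

/-- For `r ≤ T`, the time `s = w - log r` with `|w| ≤ L` satisfies
`e ^ (s a + ε |s|) ≤ C r ^ (-(a + ε))`, uniformly in `|a| ≤ A`. -/
theorem exp_mul_add_le_mul_rpow {r T L A a ε w : ℝ} (hr : 0 < r) (hrT : r ≤ T) (hε : 0 < ε)
    (hw : |w| ≤ L) (ha : |a| ≤ A) :
    Real.exp ((w - Real.log r) * a + ε * |w - Real.log r|) ≤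
      Real.exp (L * A + ε * (L + 2 * |Real.log T|)) * r ^ (-(a + ε)) := by
  rw [Real.rpow_def_of_pos hr, ← Real.exp_add, Real.exp_le_exp]
  have hlog : Real.log r ≤ |Real.log T| := (Real.log_le_log hr hrT).trans (le_abs_self _)
  have h1 : |Real.log r| ≤ 2 * |Real.log T| - Real.log r := by
    rw [abs_le]
    constructor <;> linarith [abs_nonneg (Real.log T)]
  have h2 : |w - Real.log r| ≤ L + (2 * |Real.log T| - Real.log r) :=
    (abs_sub _ _).trans (add_le_add hw h1)
  have h3 : w * a ≤ L * A := by
    refine (le_abs_self _).trans ?_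
    rw [abs_mul]
    exact mul_le_mul hw ha (abs_nonneg _) ((abs_nonneg _).trans hw)
  have h4 := mul_le_mul_of_nonneg_left h2 hε.le
  linarith

/-- The set of frequencies `y` with `r ^ Eᵀ y` near `l / ‖l‖²` has measure of order `r ^ (-q)`; on
it `⟨t, y⟩ = ⟨l, r ^ Eᵀ y⟩` is near `1` and `ψ y` is of order `1 / r`, so that the integrand is at
least of order `r ^ q ∑ⱼ (r ^ (λⱼ + ε) |θⱼ|) ^ α`. -/
theorem exists_le_lintegral_harmonizableKernel {d m : ℕ} {α : ℝ} (hα : 0 < α)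
    {E : Matrix (Fin d) (Fin d) ℝ} {D : Matrix (Fin m) (Fin m) ℝ} {lam : Fin m → ℝ}
    (hD : IsNearlyNormal D lam) (hlam : ∀ j, |lam j| ≤ 1) {ψ : EuclideanSpace ℝ (Fin d) → ℝ}
    (hψ : IsHomogeneousWeight E ψ) {N : Seminorm ℝ (EuclideanSpace ℝ (Fin d))}
    (hN : ∀ x, N x = 0 → x = 0) {ε : ℝ} (hε : 0 < ε) (T : ℝ) :
    ∃ C : ℝ, 0 < C ∧ ∀ (r : ℝ) (l : EuclideanSpace ℝ (Fin d)), 0 < r → r ≤ T → N l = 1 →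
      ∀ θ : EuclideanSpace ℝ (Fin m),
        ENNReal.ofReal (C * ∑ j, |(r ^ (lam j + ε) * |θ j|)| ^ α) ≤
          ∫⁻ y, ‖matAct (harmonizableKernel α E D ψ (matAct (matPow r E) l) y).conjTranspose
            (toComplexVec θ)‖ₑ ^ α := by
  obtain ⟨c₁, hc₁, hN₁⟩ := N.exists_le_mul_norm
  obtain ⟨c₂, hc₂, hN₂⟩ := Seminorm.exists_norm_le_mul hN
  -- `‖l‖ ≤ c₂`, so `⟨l, z⟩` varies by at most `1 / 2` on a ball of radius `ρ`
  set ρ : ℝ := 1 / (2 * c₂) with hρ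
  have hρ0 : 0 < ρ := by positivity
  obtain ⟨L, hL⟩ := hψ.exists_abs_log_le hρ0 (c₁ + ρ)
  set κ : ℝ := E.trace / α with hκ
  obtain ⟨K, hK, hθ⟩ := hD.exists_abs_le κ hε
  set G : ℝ := Real.exp (L * (1 + |κ|) + ε * (L + 2 * |Real.log T|)) with hG
  set v : ℝ := (volume (Metric.ball (0 : EuclideanSpace ℝ (Fin d)) ρ)).toReal with hv
  have hv0 : 0 < v := ENNReal.toReal_pos (Metric.measure_ball_pos _ _ hρ0).ne'
    measure_ball_lt_top.ne
  -- `m + 1` rather than `m`, so that the denominator is nonzero when `m = 0`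
  set C₀ : ℝ := (1 / Real.pi) ^ α / ((m + 1) * (K * G) ^ α) with hC₀
  have hC₀pos : 0 < C₀ := by positivity
  refine ⟨C₀ * v, by positivity, fun r l hr hrT hl θ => ?_⟩
  have hl0 : 0 < ‖l‖ := by
    have := hN₁ l
    rw [hl] at this
    by_contra h
    have h' : ‖l‖ = 0 := le_antisymm (not_lt.1 h) (norm_nonneg _)
    rw [h', mul_zero] at this
    linarith
  have hl1 : 1 / c₂ ≤ 1 / ‖l‖ := by
    have := hN₂ l
    rw [hl, mul_one] at this
    exact one_div_le_one_div_of_le hl0 this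
  have hl2 : 1 / ‖l‖ ≤ c₁ := by
    have := hN₁ l
    rw [hl] at this
    rwa [div_le_iff₀ hl0]
  -- the centre is chosen so that `⟨l, z₀⟩ = 1`
  set z₀ : EuclideanSpace ℝ (Fin d) := (‖l‖ ^ 2)⁻¹ • l with hz₀
  have hz₀n : ‖z₀‖ = 1 / ‖l‖ := by
    rw [hz₀, norm_smul, norm_inv, norm_pow, norm_norm]
    field_simp
  have hz₀l : inner ℝ l z₀ = 1 := by
    rw [hz₀, inner_smul_right, real_inner_self_eq_norm_sq]
    field_simp
  set Sθ : ℝ := ∑ j, |(r ^ (lam j + ε) * |θ j|)| ^ α with hSθ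
  have hSθ0 : 0 ≤ Sθ := Finset.sum_nonneg fun j _ => by positivity
  set A : Set (EuclideanSpace ℝ (Fin d)) :=
    matAct (matPow r E.transpose) ⁻¹' Metric.ball z₀ ρ with hA
  have hAm : MeasurableSet A := by
    have hcont : Continuous (matAct (matPow r E.transpose)) :=
      ContinuousLinearMap.continuous _
    exact (Metric.isOpen_ball.preimage hcont).measurableSet
  have hvol : volume A = ENNReal.ofReal (r ^ (-E.trace) * v) := by
    rw [hA, volume_preimage_matAct_matPow _ hr, Matrix.trace_transpose,
      ENNReal.ofReal_mul (by positivity), hv, ENNReal.ofReal_toReal measure_ball_lt_top.ne,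
      Measure.addHaar_ball_center]
  have hpt : ∀ y ∈ A, ENNReal.ofReal (C₀ * (r ^ E.trace * Sθ)) ≤
      ‖matAct (harmonizableKernel α E D ψ (matAct (matPow r E) l) y).conjTranspose
            (toComplexVec θ)‖ₑ ^ α := by
    intro y hy
    set z := matAct (matPow r E.transpose) y with hz
    have hzdist : ‖z - z₀‖ < ρ := by
      rw [← dist_eq_norm]
      exact hy
    have hinner : inner ℝ (matAct (matPow r E) l) y = inner ℝ l z := by
      rw [inner_matAct_left, transpose_matPow]
    have hdev : |inner ℝ l z - 1| ≤ 1 / 2 := by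
      have hsub : inner ℝ l z - 1 = inner ℝ l (z - z₀) := by rw [inner_sub_right, hz₀l]
      rw [hsub]
      refine (abs_real_inner_le_norm _ _).trans ?_
      have hc : ‖l‖ ≤ c₂ := by
        have := hN₂ l
        rwa [hl, mul_one] at this
      calc ‖l‖ * ‖z - z₀‖ ≤ c₂ * ρ := by gcongr
        _ = 1 / 2 := by rw [hρ]; field_simp
    have hexp := one_div_pi_le_norm_exp_sub_one (x := inner ℝ l z)
      (by linarith [(abs_le.1 hdev).1]) (by linarith [(abs_le.1 hdev).2])
    have hzlow : ρ ≤ ‖z‖ := by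
      have h1 : ‖z₀‖ - ‖z - z₀‖ ≤ ‖z‖ := by
        have := norm_sub_norm_le z₀ (z₀ - z)
        rw [sub_sub_cancel, norm_sub_rev z₀ z] at this
        exact this
      have h2 : 1 / c₂ = 2 * ρ := by rw [hρ]; field_simp
      linarith
    have hzup : ‖z‖ ≤ c₁ + ρ := by
      have := norm_add_le z₀ (z - z₀)
      rw [add_sub_cancel] at this
      linarith
    have hψz : ψ z ≠ 0 := hψ.ne_zero z (norm_pos_iff.1 (hρ0.trans_le hzlow))
    have hψy : Real.log (ψ y) = Real.log (ψ z) - Real.log r := by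
      have h1 : ψ z = r * ψ y := hψ.homogeneous r hr y
      have h2 : ψ y ≠ 0 := fun h => hψz (by rw [h1, h, mul_zero])
      rw [h1, Real.log_mul hr.ne' h2]
      ring
    have hnorm := norm_matAct_harmonizableKernel α E D ψ (matAct (matPow r E) l) y θ
    rw [hinner, matPow_eq_exp (ψ y), hψy, ← hκ] at hnorm
    set u := ‖matAct (NormedSpace.exp ((Real.log (ψ z) - Real.log r) •
      (-D - κ • (1 : Matrix (Fin m) (Fin m) ℝ)))).transpose θ‖ with hu
    have hu0 : 0 ≤ u := norm_nonneg _
    have hcoord : ∀ j, |(r ^ (lam j + ε) * |θ j|)| ^ α * r ^ E.trace ≤ (K * G) ^ α * u ^ α := by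
      intro j
      have h1 : |θ j| ≤ K * (G * r ^ (-(lam j + κ + ε))) * u := by
        refine (hθ (Real.log (ψ z) - Real.log r) θ j).trans ?_
        gcongr
        exact exp_mul_add_le_mul_rpow hr hrT hε (hL z hzlow hzup)
          ((abs_add_le _ _).trans (by gcongr; exact hlam j))
      have h2 : r ^ (lam j + ε) * |θ j| * r ^ κ ≤ K * G * u := by
        have h3 : r ^ (lam j + ε) * r ^ κ * r ^ (-(lam j + κ + ε)) = 1 := by
          rw [← Real.rpow_add hr, ← Real.rpow_add hr]
          ring_nf
          exact Real.rpow_zero r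
        calc r ^ (lam j + ε) * |θ j| * r ^ κ
            ≤ r ^ (lam j + ε) * (K * (G * r ^ (-(lam j + κ + ε))) * u) * r ^ κ := by gcongr
          _ = K * G * u * (r ^ (lam j + ε) * r ^ κ * r ^ (-(lam j + κ + ε))) := by ring
          _ = K * G * u := by rw [h3, mul_one]
      have h4 : (r ^ κ) ^ α = r ^ E.trace := by
        rw [← Real.rpow_mul hr.le, hκ, div_mul_cancel₀ _ hα.ne']
      rw [abs_of_nonneg (by positivity : 0 ≤ r ^ (lam j + ε) * |θ j|), ← h4,
        ← Real.mul_rpow (by positivity) (by positivity), ← Real.mul_rpow (by positivity) hu0]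
      exact Real.rpow_le_rpow (by positivity) h2 hα.le
    have hsum : r ^ E.trace * Sθ ≤ (m + 1) * (K * G) ^ α * u ^ α := by
      calc r ^ E.trace * Sθ = ∑ j, |(r ^ (lam j + ε) * |θ j|)| ^ α * r ^ E.trace := by
            rw [mul_comm, hSθ, Finset.sum_mul]
        _ ≤ ∑ _j : Fin m, (K * G) ^ α * u ^ α := Finset.sum_le_sum fun j _ => hcoord j
        _ = m * ((K * G) ^ α * u ^ α) := by simp
        _ ≤ _ := by
            rw [mul_assoc]
            gcongr
            linarith
    rw [← ofReal_norm, ENNReal.ofReal_rpow_of_nonneg (norm_nonneg _) hα.le, hnorm,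
      Real.mul_rpow (norm_nonneg _) hu0]
    refine ENNReal.ofReal_le_ofReal ?_
    calc C₀ * (r ^ E.trace * Sθ) ≤ C₀ * ((m + 1) * (K * G) ^ α * u ^ α) := by gcongr
      _ = (1 / Real.pi) ^ α * u ^ α := by
          rw [hC₀, ← mul_assoc, div_mul_cancel₀ _ (by positivity)]
      _ ≤ _ := by gcongr
  calc ENNReal.ofReal (C₀ * v * Sθ)
      = ENNReal.ofReal (C₀ * (r ^ E.trace * Sθ)) * volume A := by
        have h1 : r ^ E.trace * r ^ (-E.trace) = 1 := by
          rw [← Real.rpow_add hr, add_neg_cancel, Real.rpow_zero]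
        rw [hvol, ← ENNReal.ofReal_mul (by positivity)]
        congr 1
        calc C₀ * v * Sθ = C₀ * v * Sθ * (r ^ E.trace * r ^ (-E.trace)) := by rw [h1, mul_one]
          _ = _ := by ring
    _ = ∫⁻ _y in A, ENNReal.ofReal (C₀ * (r ^ E.trace * Sθ)) := (setLIntegral_const _ _).symm
    _ ≤ _ := (setLIntegral_mono' hAm hpt).trans (setLIntegral_le_lintegral _ _)

theorem radialPart_eq_zero_or {d : ℕ} (E : Matrix (Fin d) (Fin d) ℝ)
    (N : Seminorm ℝ (EuclideanSpace ℝ (Fin d))) (x : EuclideanSpace ℝ (Fin d)) :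
    radialPart E N x = 0 ∨ 0 < radialPart E N x ∧
      ∃ l, N l = 1 ∧ x = matAct (matPow (radialPart E N x) E) l := by
  unfold radialPart
  split_ifs with h
  · exact Or.inr h.choose_spec
  · exact Or.inl rfl

/-! ### The estimate for the characteristic function -/

theorem lemma5p2
    (d m : ℕ) (α : ℝ) (hα0 : 0 < α) (hα2 : α < 2)
    (E : Matrix (Fin d) (Fin d) ℝ) (D : Matrix (Fin m) (Fin m) ℝ)
    -- the real parts of the eigenvalues of `E` exceed `1`
    (hE : ∀ a ∈ eigenvalueRealParts E, 1 < a)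
    -- `lam 0 ≤ lam 1 ≤ …` are the real parts of the eigenvalues of `D`; they lie in `(0, 1)`
    (lam : Fin m → ℝ) (hlam_mono : Monotone lam)
    (hlam : eigenvalueRealParts D = Finset.univ.val.map lam)
    (hlam_pos : ∀ j, 0 < lam j) (hlam_lt : ∀ j, lam j < 1)
    -- real canonical form; its blocks are arranged in the order of the `lam j`
    (hD : IsRealCanonicalForm D) (hD_diag : ∀ j, D j j = lam j)
    (ψ : EuclideanSpace ℝ (Fin d) → ℝ) (hψ : IsHomogeneousWeight E ψ)
    (N : Seminorm ℝ (EuclideanSpace ℝ (Fin d))) (hN : IsPolarNorm E N)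
    (ε : ℝ) (hε : 0 < ε) (T : ℝ) (hT : 0 < T) :
    ∃ C : ℝ, 0 < C ∧
      ∀ {Ω : Type*} [MeasurableSpace Ω] (P : Measure Ω) [IsProbabilityMeasure P]
        (W : Set (EuclideanSpace ℝ (Fin d)) → Ω → EuclideanSpace ℂ (Fin m))
        (X : EuclideanSpace ℝ (Fin d) → Ω → EuclideanSpace ℝ (Fin m)),
        IsIsotropicStableMeasure P α W → IsHarmonizableField P α W E D ψ X →
        ∀ t : EuclideanSpace ℝ (Fin d), radialPart E N t ≤ T → ∀ θ : EuclideanSpace ℝ (Fin m),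
          -- the order of `ℂ`: the left-hand side is real and at most the right-hand side
          ∫ ω, Complex.exp (Complex.I * (inner ℝ (X t ω) θ : ℝ)) ∂P
            ≤ (Real.exp (-(C * ∑ j, |(radialPart E N t ^ (lam j + ε) * |θ j|)| ^ α)) : ℂ) := by
  have hDn : IsNearlyNormal D lam := by
    have h := hD.isNearlyNormal
    rwa [funext hD_diag] at h
  obtain ⟨C, hC, hbound⟩ := exists_le_lintegral_harmonizableKernel hα0 hDn
    (fun j => by rw [abs_of_pos (hlam_pos j)]; exact (hlam_lt j).le) hψ hN.eq_zero hε T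
  refine ⟨C / 2 ^ α, by positivity, ?_⟩
  intro Ω _ P _ W X hW hX t ht θ
  obtain ⟨Y, hY, hXY⟩ := hX t
  set Sθ : ℝ := ∑ j, |(radialPart E N t ^ (lam j + ε) * |θ j|)| ^ α with hSθ
  have hlower : ENNReal.ofReal (C * Sθ) ≤
      ∫⁻ y, ‖matAct (harmonizableKernel α E D ψ t y).conjTranspose (toComplexVec θ)‖ₑ ^ α := by
    rcases radialPart_eq_zero_or E N t with h0 | ⟨hpos, l, hl, htl⟩
    · -- the exponents `λⱼ + ε` are positive, so the right-hand side is `1` at `t = 0`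
      have hzero : Sθ = 0 := Finset.sum_eq_zero fun j _ => by
        rw [h0, Real.zero_rpow (add_pos (hlam_pos j) hε).ne', zero_mul, abs_zero,
          Real.zero_rpow hα0.ne']
      simp [hzero]
    · have h := hbound _ l hpos ht hl θ
      rwa [← htl] at h
  obtain ⟨L, hL, hle⟩ := hY.exists_integral_exp_eq hα0 hW (toComplexVec θ) hlower
  have hint : ∫ ω, Complex.exp (Complex.I * (inner ℝ (X t ω) θ : ℝ)) ∂P = (L : ℂ) := by
    rw [← hL]
    refine integral_congr_ae ?_
    filter_upwards [hXY] with ω hω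
    have h : inner ℝ (X t ω) θ = (inner ℂ (toComplexVec θ) (Y ω)).re := by
      simp [PiLp.inner_apply, toComplexVec, hω, mul_comm]
    rw [h]
  rw [hint, Complex.real_le_real]
  rwa [div_mul_eq_mul_div]
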